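/- All groups are finite. Let $G$ be a group, let $\mathbb P$ be the set of all primes, let $\emptyset\ne\pi\subseteq\mathbb P$ and $\pi'=\mathbb P\setminus\pi$. A Fitting set of $G$ is a nonempty set $\mathcal F$ of subgroups of $G$ such that (i) $T\trianglelefteq S\in\mathcal F$ implies $T\in\mathcal F$; (ii) if $S,T\in\mathcal F$ and $S,T\trianglelefteq ST$, then $ST\in\mathcal F$; (iii) $S\in\mathcal F$ and $x\in G$ imply $S^x\in\mathcal F$. For $H\le G$, the $\mathcal F$-radical $H_{\mathcal F}$ is the join of all normal subgroups of $H$ that belong to $\mathcal F$. For a class $\mathfrak X$ of groups put $\mathcal F\circ\mathfrak X=\{H\le G : H/H_{\mathcal F}\in\mathfrak X\}$. Let $\mathfrak E_{p'}$ and $\mathfrak N_p$ denote the classes of all $p'$-groups and of all $p$-groups, respectively. A group is $\pi$-soluble if it has a normal series each of whose factors is a $\pi'$-group or a $p$-group for some $p\in\pi$. A subgroup $V\le K$ is $\mathcal F$-maximal in a subgroup $K\le G$ if $V\in\mathcal F$ and $V\le U\le K$, $U\in\mathcal F$ imply $U=V$; and $V\le G$ is an $\mathcal F$-injector of $G$ if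 $V\cap K$ is $\mathcal F$-maximal in $K$ for every subnormal subgroup $K$ of $G$. **Theorem B.** Let $f$ be an H-function of $G$, that is, a function from $\mathbb P$ to the set of Fitting sets of $G$, and let $\mathcal F$ be a Fitting set of $G$ with $\mathcal F=\bigcap_{p\in\pi}f(p)\circ\mathfrak E_{p'}$ (so $\mathcal F$ is $\pi$-semilocal, defined by $f$). Suppose that $f$ is full, i.e. $f(p)=f(p)\circ\mathfrak N_p$ for all $p\in\pi$, and invariable, i.e. $f(p)=f(q)$ for all $p,q\in\pi$. Let $G_f=\prod_{p\in\pi}G_{f(p)}$ be the $f$-radical of $G$, and suppose that $G/G_f$ is $\pi$-soluble. Then: 1. A subgroup $V$ of $G$ is an $\mathcal F$-injector of $G$ if and only if $G_f\le V$ and $V/G_f$ is a Hall $\pi'$-subgroup of $G/G_f$. 2. $G$ possesses an $\mathcal F$-injector, and any two $\mathcal F$-injectors are conjugate in $G$. 3. A subgroup $V$ of $G$ is an $\mathcal F$-injector of $G$ if and only if $V$ is an $\mathcal F$-maximal subgroup of $G$ and $G_{\mathcal F}\le V$. 4. If $G$ is $\pi$-soluble, then the $\mathcal F$-injectors of $G$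 are exactly the subgroups $G_{\pi'}G_f$ with $G_{\pi'}$ a Hall $\pi'$-subgroup of $G$. -/

import Mathlib

open scoped Pointwise

universe u

/-- A Fitting set of a group `G`: a nonempty set of subgroups of `G` which is closed under normal
subgroups, under products `ST` of members `S`, `T` that are both normal in `ST`, and under
conjugation in `G`. (`S` and `T` are normal in their join exactly when `ST` is a subgroup in which
both are normal, and then `S ⊔ T = ST`.) -/
structure FittingSet (G : Type u) [Group G] where
  carrier : Set (Subgroup G)
  nonempty' : carrier.Nonempty
  normal_mem' : ∀ S T : Subgroup G, S ∈ carrier → T ≤ S → (T.subgroupOf S).Normal → T ∈ carrier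
  mul_mem' : ∀ S T : Subgroup G, S ∈ carrier → T ∈ carrier →
    (S.subgroupOf (S ⊔ T)).Normal → (T.subgroupOf (S ⊔ T)).Normal → S ⊔ T ∈ carrier
  conj_mem' : ∀ (S : Subgroup G) (x : G), S ∈ carrier →
    S.map (MulAut.conj x).toMonoidHom ∈ carrier

instance FittingSet.instSetLike (G : Type u) [Group G] : SetLike (FittingSet G) (Subgroup G) where
  coe := FittingSet.carrier
  coe_injective := by
    intro A B h
    cases A
    cases B
    cases h
    rfl

/-- The `F`-radical of a subgroup `H`: the join of all normal subgroups of `H` belonging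
to `F`. -/
def FittingSet.radical {G : Type u} [Group G] (F : FittingSet G) (H : Subgroup G) : Subgroup G :=
  sSup {N : Subgroup G | N ≤ H ∧ (N.subgroupOf H).Normal ∧ N ∈ F}

theorem FittingSet.radical_le {G : Type u} [Group G] (F : FittingSet G) (H : Subgroup G) :
    F.radical H ≤ H :=
  sSup_le fun _ hN => hN.1

instance FittingSet.radical_subgroupOf_normal {G : Type u} [Group G] (F : FittingSet G)
    (H : Subgroup G) : ((F.radical H).subgroupOf H).Normal := by
  rw [Subgroup.normal_subgroupOf_iff (F.radical_le H)]
  intro x k hx hk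
  have key : F.radical H ≤ (F.radical H).comap (MulAut.conj k).toMonoidHom := by
    refine sSup_le fun N hN y hy => ?_
    have h1 : k * y * k⁻¹ ∈ N := (Subgroup.normal_subgroupOf_iff hN.1).1 hN.2.1 y k hy hk
    have h2 : N ≤ F.radical H := le_sSup hN
    simpa using h2 h1
  simpa using key hx

instance FittingSet.radical_top_normal {G : Type u} [Group G] (F : FittingSet G) :
    (F.radical ⊤).Normal := by
  have h := (Subgroup.normal_subgroupOf_iff (F.radical_le ⊤)).1 (F.radical_subgroupOf_normal ⊤)
  exact ⟨fun n hn g => h n g hn (Subgroup.mem_top g)⟩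

/-- A class of groups (in a fixed universe), given by its membership predicate. -/
def GroupClass : Type (u + 1) := (Q : Type u) → [Group Q] → Prop

/-- All prime divisors of the natural number `n` lie in `σ`. -/
def IsPrimeSetNumber (σ : Set Nat.Primes) (n : ℕ) : Prop :=
  ∀ p : Nat.Primes, (p : ℕ) ∣ n → p ∈ σ

/-- The class of all finite `σ`-groups. -/
def sigmaGroups (σ : Set Nat.Primes) : GroupClass.{u} :=
  fun Q _ => Finite Q ∧ IsPrimeSetNumber σ (Nat.card Q)

/-- The class of all finite (automatically nilpotent) `p`-groups. -/
def finitePGroups (p : Nat.Primes) : GroupClass.{u} :=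
  fun Q _ => Finite Q ∧ IsPGroup (p : ℕ) Q

/-- The product `F ∘ X` of a Fitting set `F` of `G` and a class `X` of groups: the set of all
subgroups `H` of `G` such that `H / H_F` belongs to `X`. -/
def FittingSet.comp {G : Type u} [Group G] (F : FittingSet G) (X : GroupClass.{u}) :
    Set (Subgroup G) :=
  {H | X (↥H ⧸ (F.radical H).subgroupOf H)}

/-- A Hartley function of `G`. -/
abbrev HFunction (G : Type u) [Group G] : Type u := Nat.Primes → FittingSet G

/-- `SLR(f)`: the intersection of the products of `f p` with the class of finite `p'`-groups,
over `p ∈ π`. -/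
def HFunction.SLR {G : Type u} [Group G] (π : Set Nat.Primes) (f : HFunction G) :
    Set (Subgroup G) :=
  ⋂ p ∈ π, (f p).comp (sigmaGroups {p}ᶜ)

/-- `F` is `π`-semilocal, defined by the H-function `f`. -/
def FittingSet.IsDefinedBy {G : Type u} [Group G] (F : FittingSet G) (π : Set Nat.Primes)
    (f : HFunction G) : Prop :=
  (F : Set (Subgroup G)) = HFunction.SLR π f

/-- `f` is full: `f p = f p ∘ N_p` for all `p ∈ π`, with `N_p` the class of finite `p`-groups. -/
def HFunction.IsFull {G : Type u} [Group G] (π : Set Nat.Primes) (f : HFunction G) : Prop :=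
  ∀ p ∈ π, (f p : Set (Subgroup G)) = (f p).comp (finitePGroups p)

/-- `f` is invariable: it is constant on `π`. -/
def HFunction.IsInvariable {G : Type u} [Group G] (π : Set Nat.Primes) (f : HFunction G) : Prop :=
  ∀ p ∈ π, ∀ q ∈ π, f p = f q

/-- The `f`-radical `G_f` of `G`: the product of the radicals of `G` with respect to `f p`,
over `p ∈ π`. -/
def HFunction.radical {G : Type u} [Group G] (π : Set Nat.Primes) (f : HFunction G) :
    Subgroup G :=
  ⨆ p : π, (f p).radical ⊤

instance HFunction.radical_normal {G : Type u} [Group G] (π : Set Nat.Primes) (f : HFunction G) :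
    (HFunction.radical π f).Normal :=
  Subgroup.iSup_normal _

/-- A (finite) group is `π`-soluble if it has a normal series each of whose factors is either a
`π'`-group or a `p`-group for some `p ∈ π`. Here `(H i).relIndex (H (i + 1))` is the order of the
factor `H (i + 1) / H i`. -/
def IsPiSoluble (π : Set Nat.Primes) (Q : Type u) [Group Q] : Prop :=
  ∃ (n : ℕ) (H : ℕ → Subgroup Q), H 0 = ⊥ ∧ H n = ⊤ ∧ (∀ i ≤ n, (H i).Normal) ∧
    ∀ i < n, H i ≤ H (i + 1) ∧
      (IsPrimeSetNumber πᶜ ((H i).relIndex (H (i + 1))) ∨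
        ∃ p ∈ π, ∃ k : ℕ, (H i).relIndex (H (i + 1)) = (p : ℕ) ^ k)

/-- `H` is a Hall `σ`-subgroup of the (finite) group `Q`: its order is a `σ`-number and its index
is a `σ'`-number. -/
def IsHallSubgroup {Q : Type u} [Group Q] (σ : Set Nat.Primes) (H : Subgroup Q) : Prop :=
  IsPrimeSetNumber σ (Nat.card H) ∧ IsPrimeSetNumber σᶜ H.index

/-- `V` is an `F`-maximal subgroup of the subgroup `K`. -/
def FittingSet.IsMaximalIn {G : Type u} [Group G] (F : FittingSet G) (K V : Subgroup G) : Prop :=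
  V ≤ K ∧ V ∈ F ∧ ∀ U : Subgroup G, V ≤ U → U ≤ K → U ∈ F → U = V

/-- `V` is an `F`-injector of `G`: the intersection of `V` with each subnormal subgroup `K` of `G`
is an `F`-maximal subgroup of `K`. -/
def FittingSet.IsInjector {G : Type u} [Group G] (F : FittingSet G) (V : Subgroup G) : Prop :=
  ∀ K : Subgroup G, K.IsSubnormal → F.IsMaximalIn K (V ⊓ K)

-- Invariability gives one Fitting set `X`, the common value of `f` on `π`. Then `G_f` is the
-- `X`-radical `N` of `G`, and being an extension of the `X`-radical by a `p'`-group for every `p ∈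
-- π` means being one by a `π'`-group (`IsExtensionBy`).
--
-- Let `R` be the `F`-radical of `G`. Radicals of normal subgroups are intersections, so `R/N` is
-- the largest normal `π'`-subgroup of `G/N`, and fullness leaves `G/N` without nontrivial normal
-- `p`-subgroups for `p ∈ π`. A Hall–Higman argument for `π`-soluble groups
-- (`IsPiSoluble.centralizer_le`) then shows that `R/N` contains its centralizer.
--
-- If `R ≤ V`, the `X`-radical of `V` meets `R` in `N`. Hence it centralizes `R/N`, lies in `R`, and
-- equals `N` (`radical_eq`). So such a `V` lies in `F` exactly when `V/N` is a `π'`-group, and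
-- Hall's theorem for `π`-soluble groups identifies the `F`-maximal subgroups above `R` with the
-- preimages of Hall `π'`-subgroups. Everything passes to a subnormal `K`, whose `X`-radical is `N ∩
-- K`, so these preimages are injectors. Conversely, every injector is `F`-maximal and contains `R`.

universe v

/-! ### Arithmetic of `σ`-numbers. -/

namespace IsPrimeSetNumber

variable {σ : Set Nat.Primes} {m n : ℕ}

theorem one (σ : Set Nat.Primes) : IsPrimeSetNumber σ 1 :=
  fun p hp => absurd (Nat.dvd_one.1 hp) p.2.ne_one

theorem dvd (hn : IsPrimeSetNumber σ n) (h : m ∣ n) : IsPrimeSetNumber σ m :=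
  fun p hp => hn p (hp.trans h)

theorem mul (hm : IsPrimeSetNumber σ m) (hn : IsPrimeSetNumber σ n) :
    IsPrimeSetNumber σ (m * n) :=
  fun p hp => (p.2.dvd_mul.1 hp).elim (hm p) (hn p)

theorem coprime (hm : IsPrimeSetNumber σ m) (hn : IsPrimeSetNumber σᶜ n) : m.Coprime n :=
  Nat.coprime_of_dvd fun p hp h1 h2 => hn ⟨p, hp⟩ h2 (hm ⟨p, hp⟩ h1)

theorem eq_one (hm : IsPrimeSetNumber σ m) (hn : IsPrimeSetNumber σᶜ m) : m = 1 :=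
  (Nat.coprime_self m).1 (hm.coprime hn)

theorem prime_pow {p : Nat.Primes} (hp : p ∈ σ) (k : ℕ) : IsPrimeSetNumber σ ((p : ℕ) ^ k) := by
  intro q hq
  have h : q = p := Subtype.ext ((Nat.prime_dvd_prime_iff_eq q.2 p.2).1 (q.2.dvd_of_dvd_pow hq))
  rwa [h]

end IsPrimeSetNumber

/-! ### Divisibility of indices; coprime complements of abelian normal subgroups. -/

namespace Subgroup

variable {G : Type u} [Group G]

theorem relIndex_dvd_relIndex_of_normal {H K L : Subgroup G} (hKL : K ≤ L)
    (hn : (H.subgroupOf L).Normal) : H.relIndex K ∣ H.relIndex L := by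
  rw [← relIndex_subgroupOf hKL]
  exact relIndex_dvd_index_of_normal _ _

/-- Comparing orders in the product `VK` gives `|VK : V| = |K : V ∩ K|`. -/
theorem relIndex_dvd_index_of_normal_right [Finite G] (V K : Subgroup G) [K.Normal] :
    V.relIndex K ∣ V.index := by
  have h1 : V.relIndex (V ⊔ K) ∣ V.index := relIndex_dvd_index_of_le le_sup_left
  have h2 : V.relIndex (V ⊔ K) = V.relIndex K := by
    have h0 : ∀ {A B : Subgroup G}, A ≤ B → Nat.card A * A.relIndex B = Nat.card B := by
      intro A B h
      simpa only [relIndex_bot_left] using relIndex_mul_relIndex ⊥ A B bot_le h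
    have a := h0 (le_sup_left : V ≤ V ⊔ K)
    have b := h0 (le_sup_right : K ≤ V ⊔ K)
    have c := h0 (inf_le_left : V ⊓ K ≤ V)
    have d := h0 (inf_le_right : V ⊓ K ≤ K)
    rw [relIndex_sup_right] at b
    rw [inf_relIndex_left] at c
    rw [inf_relIndex_right] at d
    refine Nat.eq_of_mul_eq_mul_left (Nat.card_pos (α := V)) (a.trans ?_)
    rw [← b, ← c, ← d]
    ring
  exact h2 ▸ h1

theorem relIndex_dvd_relIndex_of_normal_right [Finite G] (V : Subgroup G) {K L : Subgroup G}
    (hKL : K ≤ L) (hn : (K.subgroupOf L).Normal) : V.relIndex K ∣ V.relIndex L := by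
  rw [← relIndex_subgroupOf hKL]
  exact relIndex_dvd_index_of_normal_right _ _

/-- `N` acts transitively on `N.QuotientDiff`, and every complement is the stabilizer of a point: it
fixes its own class as a transversal, and orders agree. -/
theorem exists_conj_eq_of_isComplement' [Finite G] {N : Subgroup G} [N.Normal]
    [IsMulCommutative N] (hN : (Nat.card N).Coprime N.index) {K L : Subgroup G}
    (hK : IsComplement' N K) (hL : IsComplement' N L) :
    ∃ g : G, L = K.map (MulAut.conj g).toMonoidHom := by
  have key : ∀ {K : Subgroup G} (hK : IsComplement' N K), ∃ α : N.QuotientDiff,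
      K = MulAction.stabilizer G α := by
    intro K hK
    let α : N.QuotientDiff := Quotient.mk'' ⟨K, hK.symm⟩
    refine ⟨α, ?_⟩
    have hs := isComplement'_stabilizer_of_coprime (α := α) hN
    have hle : K ≤ MulAction.stabilizer G α := by
      intro k hk
      rw [MulAction.mem_stabilizer_iff]
      change Quotient.mk'' (MulOpposite.op k⁻¹ • (⟨(K : Set G), hK.symm⟩ : N.LeftTransversal)) = α
      congr 1
      refine Subtype.ext ?_
      exact rightCoset_mem_rightCoset K (K.inv_mem hk)
    have hc : Nat.card K = Nat.card (MulAction.stabilizer G α) :=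
      Nat.eq_of_mul_eq_mul_left Nat.card_pos (hK.card_mul_card.trans hs.card_mul_card.symm)
    exact eq_of_le_of_card_ge hle hc.ge
  obtain ⟨α, hα⟩ := key hK
  obtain ⟨β, hβ⟩ := key hL
  obtain ⟨n, hn⟩ := exists_smul_eq hN α β
  refine ⟨n, ?_⟩
  rw [hβ, hα, ← hn]
  exact MulAction.stabilizer_smul_eq_stabilizer_map_conj (n : G) α

/-- By Dedekind's law, `A` and `K ∩ NA` are both complements of `N` in `NA`, hence conjugate there.
-/
theorem exists_le_conj_of_le_sup [Finite G] {N : Subgroup G} [N.Normal] [IsMulCommutative N]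
    {K A : Subgroup G} (hK : (Nat.card N).Coprime (Nat.card K))
    (hA : (Nat.card N).Coprime (Nat.card A)) (hAK : A ≤ N ⊔ K) :
    ∃ g : G, A ≤ K.map (MulAut.conj g).toMonoidHom := by
  set B := N ⊔ A with hB
  have compl : ∀ {C : Subgroup G}, (Nat.card N).Coprime (Nat.card C) → B ≤ N ⊔ C →
      IsComplement' (N.subgroupOf B) (C.subgroupOf B) := by
    intro C hC hBC
    refine isComplement'_of_disjoint_and_mul_eq_univ ?_ ?_
    · rw [disjoint_def]
      rintro x hx hx'
      exact Subtype.ext (disjoint_def.1 (disjoint_of_coprime_natCard hC) hx hx')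
    · rw [Set.eq_univ_iff_forall]
      rintro ⟨b, hb⟩
      obtain ⟨n, hn, c, hc, rfl⟩ := mem_sup_of_normal_left.1 (hBC hb)
      have hnB : n ∈ B := mem_sup_left hn
      exact ⟨⟨n, hnB⟩, hn, ⟨c, (mul_mem_cancel_left hnB).1 hb⟩, hc, rfl⟩
  have hcA := compl hA le_rfl
  have hcK := compl hK (sup_le le_sup_left hAK)
  have hcop : (Nat.card (N.subgroupOf B)).Coprime (N.subgroupOf B).index := by
    rw [hcA.symm.index_eq_card, Nat.card_congr (subgroupOfEquivOfLe (le_sup_left : N ≤ B)).toEquiv,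
      Nat.card_congr (subgroupOfEquivOfLe (le_sup_right : A ≤ B)).toEquiv]
    exact hA
  obtain ⟨g, hg⟩ := exists_conj_eq_of_isComplement' hcop hcK hcA
  refine ⟨g, fun a ha => ?_⟩
  have haB : a ∈ B := mem_sup_right ha
  have h : (⟨a, haB⟩ : B) ∈ A.subgroupOf B := ha
  rw [hg] at h
  obtain ⟨k, hk, hk'⟩ := h
  exact ⟨k, hk, congrArg Subtype.val hk'⟩

end Subgroup

/-! ### Structure of `π`-soluble groups. -/

namespace IsPiSoluble

variable {π : Set Nat.Primes} {A : Type u} {B : Type v} [Group A] [Group B]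

theorem factor_of_dvd {m n : ℕ} (h : m ∣ n)
    (hn : IsPrimeSetNumber πᶜ n ∨ ∃ p ∈ π, ∃ k : ℕ, n = (p : ℕ) ^ k) :
    IsPrimeSetNumber πᶜ m ∨ ∃ p ∈ π, ∃ k : ℕ, m = (p : ℕ) ^ k := by
  rcases hn with hn | ⟨p, hp, k, rfl⟩
  · exact Or.inl (hn.dvd h)
  · obtain ⟨j, -, hj⟩ := (Nat.dvd_prime_pow p.2).1 h
    exact Or.inr ⟨p, hp, j, hj⟩

theorem of_surjective (h : IsPiSoluble π A) (φ : A →* B) (hφ : Function.Surjective φ) :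
    IsPiSoluble π B := by
  obtain ⟨n, H, h0, hn, hN, hs⟩ := h
  refine ⟨n, fun i => (H i).map φ, by simp [h0], ?_, fun i hi => (hN i hi).map φ hφ, fun i hi =>
    ⟨Subgroup.map_mono (hs i hi).1, factor_of_dvd ?_ (hs i hi).2⟩⟩
  · change (H n).map φ = ⊤
    rw [hn, Subgroup.map_top_of_surjective φ hφ]
  · have := hN i hi.le
    rw [Subgroup.relIndex_map_map]
    have e : H (i + 1) ⊔ φ.ker = H (i + 1) ⊔ (H i ⊔ φ.ker) := by
      rw [← sup_assoc, sup_eq_left.2 (hs i hi).1]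
    rw [e, Subgroup.relIndex_sup_right]
    exact Subgroup.relIndex_dvd_of_le_left _ le_sup_left

theorem of_injective (h : IsPiSoluble π A) (φ : B →* A) (hφ : Function.Injective φ) :
    IsPiSoluble π B := by
  obtain ⟨n, H, h0, hn, hN, hs⟩ := h
  refine ⟨n, fun i => (H i).comap φ, ?_, by simp [hn], fun i hi => (hN i hi).comap φ, fun i hi =>
    ⟨Subgroup.comap_mono (hs i hi).1, factor_of_dvd ?_ (hs i hi).2⟩⟩
  · change (H 0).comap φ = ⊥
    rw [h0, MonoidHom.comap_bot, MonoidHom.ker_eq_bot_iff]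
    exact hφ
  · have := hN i hi.le
    rw [Subgroup.relIndex_comap]
    exact Subgroup.relIndex_dvd_relIndex_of_normal (Subgroup.map_comap_le _ _) inferInstance

end IsPiSoluble

namespace IsPiSoluble

variable {π : Set Nat.Primes} {Q : Type u} [Group Q] [Finite Q]

open Subgroup in
-- Climb the series, showing that each term meets the centralizer of `R` inside `R`. A `π'`-factor
-- enlarges the intersection only to a normal `π'`-group; a `p`-factor would create a nontrivial
-- normal `p`-subgroup.
theorem centralizer_le (hQ : IsPiSoluble π Q) {R : Subgroup Q} [R.Normal]
    (hR : IsPrimeSetNumber πᶜ (Nat.card R))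
    (hRmax : ∀ M : Subgroup Q, M.Normal → IsPrimeSetNumber πᶜ (Nat.card M) → M ≤ R)
    (hp : ∀ p ∈ π, ∀ P : Subgroup Q, P.Normal → IsPGroup (p : ℕ) P → P = ⊥) :
    centralizer (R : Set Q) ≤ R := by
  obtain ⟨n, H, h0, hn, hN, hs⟩ := hQ
  suffices h : ∀ i ≤ n, H i ⊓ centralizer (R : Set Q) ≤ R by
    simpa [hn] using h n le_rfl
  intro i
  induction i with
  | zero => simp [h0]
  | succ i ih =>
    intro hi
    have := hN _ hi
    have := hN i (Nat.le_of_succ_le hi)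
    set D := H (i + 1) ⊓ centralizer (R : Set Q) with hD
    have hDn : D.Normal := inferInstance
    have hle : H i ⊓ D ≤ R ⊓ D := by
      refine le_inf (le_trans ?_ (ih (Nat.le_of_succ_le hi))) inf_le_right
      exact inf_le_inf_left _ inf_le_right
    have hdvd : R.relIndex D ∣ (H i).relIndex (H (i + 1)) := by
      rw [← inf_relIndex_right R D]
      refine (relIndex_dvd_of_le_left D hle).trans ?_
      rw [inf_relIndex_right]
      exact relIndex_dvd_relIndex_of_normal inf_le_left inferInstance
    have hcard : Nat.card (R ⊓ D : Subgroup Q) * R.relIndex D = Nat.card D := by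
      have := relIndex_mul_relIndex ⊥ (R ⊓ D) D bot_le inf_le_right
      rwa [relIndex_bot_left, relIndex_bot_left, inf_relIndex_right] at this
    have hRD : IsPrimeSetNumber πᶜ (Nat.card (R ⊓ D : Subgroup Q)) :=
      hR.dvd (card_dvd_of_le inf_le_left)
    rcases factor_of_dvd hdvd (hs i hi).2 with h | ⟨p, hpπ, k, hk⟩
    · exact hRmax D hDn (hcard ▸ hRD.mul h)
    · have : Fact (p : ℕ).Prime := ⟨p.2⟩
      obtain ⟨P⟩ : Nonempty (Sylow (p : ℕ) D) := inferInstance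
      have hpR : ¬ (p : ℕ) ∣ Nat.card (R ⊓ D : Subgroup Q) := fun h => hRD p h hpπ
      have hPcard : Nat.card P = (p : ℕ) ^ k := by
        rw [P.card_eq_multiplicity, ← hcard, hk, Nat.factorization_mul Nat.card_pos.ne'
          (pow_ne_zero _ p.2.ne_zero), Finsupp.add_apply,
          Nat.factorization_eq_zero_of_not_dvd hpR, p.2.factorization_pow]
        simp
      -- `R ∩ D` is central in `D`, since `D` centralizes `R`. So the normalizer of `P` contains
      -- both `P` and `R ∩ D`, whose coprime orders multiply to `|D|`.
      have hZ : R.subgroupOf D ≤ normalizer (P : Set D) := by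
        intro x hx
        refine mem_normalizer_iff.2 fun y => ?_
        have hxy : x * y = y * x :=
          Subtype.ext (mem_centralizer_iff.1 y.2.2 x hx)
        rw [hxy, mul_inv_cancel_right]
      have hcZ : Nat.card (R.subgroupOf D) = Nat.card (R ⊓ D : Subgroup Q) := by
        rw [← inf_subgroupOf_right, Nat.card_congr (subgroupOfEquivOfLe inf_le_right).toEquiv]
      have hPn : (P : Subgroup D).Normal := by
        rw [← normalizer_eq_top_iff, ← card_eq_iff_eq_top]
        refine Nat.dvd_antisymm (card_subgroup_dvd_card _) ?_
        rw [← hcard, hk]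
        refine Nat.Coprime.mul_dvd_of_dvd_of_dvd ?_ (hcZ ▸ card_dvd_of_le hZ)
          (hPcard ▸ card_dvd_of_le le_normalizer)
        exact ((p.2.coprime_iff_not_dvd.2 hpR).pow_left k).symm
      have hPc := P.characteristic_of_normal hPn
      have hPm : ((P : Subgroup D).map D.subtype).Normal := inferInstance
      have hbot := hp p hpπ _ hPm (P.2.map D.subtype)
      have hone : Nat.card P = 1 := by
        rw [map_eq_bot_iff_of_injective _ D.subtype_injective] at hbot
        exact card_eq_one.2 hbot
      rw [← relIndex_eq_one, hk, ← hPcard, hone]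

open Subgroup in
theorem exists_normal (hQ : IsPiSoluble π Q) [Nontrivial Q] :
    ∃ N : Subgroup Q, N.Normal ∧ N ≠ ⊥ ∧ (IsPrimeSetNumber πᶜ (Nat.card N) ∨
      IsMulCommutative N ∧ IsPrimeSetNumber πᶜᶜ (Nat.card N)) := by
  obtain ⟨n, H, h0, hn, hN, hs⟩ := hQ
  have hex : ∃ i, i ≤ n ∧ H i ≠ ⊥ := ⟨n, le_rfl, hn ▸ top_ne_bot⟩
  classical
  obtain ⟨hin, hi⟩ := Nat.find_spec hex
  obtain ⟨j, hj⟩ : ∃ j, Nat.find hex = j + 1 :=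
    Nat.exists_eq_succ_of_ne_zero fun h => hi (h ▸ h0)
  have hjb : H j = ⊥ := by
    by_contra h
    exact Nat.find_min hex (m := j) (by omega) ⟨by omega, h⟩
  rw [hj] at hi hin
  have hNj := hN _ hin
  have hf := (hs j hin).2
  rw [hjb, relIndex_bot_left] at hf
  rcases hf with h | ⟨p, hp, k, hk⟩
  · exact ⟨_, hNj, hi, Or.inl h⟩
  · have : Fact (p : ℕ).Prime := ⟨p.2⟩
    have hP : IsPGroup (p : ℕ) (H (j + 1)) := IsPGroup.of_card hk
    have : Nontrivial (H (j + 1)) := (nontrivial_iff_ne_bot _).2 hi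
    have hc := hP.bot_lt_center
    -- The first nontrivial term is a `p`-group; its centre is nontrivial, abelian and
    -- characteristic.
    refine ⟨(center (H (j + 1))).map (H (j + 1)).subtype, inferInstance, ?_, Or.inr ⟨?_, ?_⟩⟩
    · rw [Ne, map_eq_bot_iff_of_injective _ (H (j + 1)).subtype_injective]
      exact hc.ne'
    · infer_instance
    · rw [compl_compl]
      refine (IsPrimeSetNumber.prime_pow hp k).dvd ?_
      rw [← hk]
      exact card_dvd_of_le (map_subtype_le _)

end IsPiSoluble

/-! ### Hall subgroups of `π`-soluble groups. -/

theorem Subgroup.mem_map_conj {G : Type u} [Group G] {H : Subgroup G} {g a : G} :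
    a ∈ H.map (MulAut.conj g).toMonoidHom ↔ g⁻¹ * a * g ∈ H := by
  constructor
  · rintro ⟨h, hh, rfl⟩
    simpa [mul_assoc] using hh
  · intro h
    exact ⟨_, h, by simp [mul_assoc]⟩

theorem Subgroup.card_map_conj {G : Type u} [Group G] (H : Subgroup G) (g : G) :
    Nat.card (H.map (MulAut.conj g).toMonoidHom) = Nat.card H :=
  card_map_of_injective (MulAut.conj g).injective

theorem IsHallSubgroup.map_conj {Q : Type u} [Group Q] {σ : Set Nat.Primes} {H : Subgroup Q}
    (hH : IsHallSubgroup σ H) (g : Q) :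
    IsHallSubgroup σ (H.map (MulAut.conj g).toMonoidHom) :=
  ⟨by rw [Subgroup.card_map_conj]; exact hH.1,
    by rw [Subgroup.index_map_of_bijective (MulAut.conj g).bijective]; exact hH.2⟩

theorem IsHallSubgroup.eq_of_le {Q : Type u} [Group Q] [Finite Q] {σ : Set Nat.Primes}
    {H A : Subgroup Q} (hH : IsHallSubgroup σ H) (hA : IsPrimeSetNumber σ (Nat.card A))
    (h : H ≤ A) : A = H := by
  refine le_antisymm (Subgroup.relIndex_eq_one.1 ?_) h
  exact (hA.dvd (Subgroup.relIndex_dvd_card H A)).eq_one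
    (hH.2.dvd (Subgroup.relIndex_dvd_index_of_le h))

theorem IsHallSubgroup.normal_le {Q : Type u} [Group Q] [Finite Q] {σ : Set Nat.Primes}
    {H R : Subgroup Q} [R.Normal] (hH : IsHallSubgroup σ H)
    (hR : IsPrimeSetNumber σ (Nat.card R)) : R ≤ H :=
  Subgroup.relIndex_eq_one.1 <| (hR.dvd (Subgroup.relIndex_dvd_card H R)).eq_one
    (hH.2.dvd (Subgroup.relIndex_dvd_index_of_normal_right H R))

theorem IsHallSubgroup.map {Q : Type u} {B : Type v} [Group Q] [Group B] {σ : Set Nat.Primes}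
    {H : Subgroup Q} (hH : IsHallSubgroup σ H) {φ : Q →* B} (hφ : Function.Surjective φ) :
    IsHallSubgroup σ (H.map φ) :=
  ⟨hH.1.dvd (Subgroup.card_map_dvd H φ), hH.2.dvd (H.index_map_dvd hφ)⟩

namespace IsPiSoluble

open Subgroup

/-- Existence and domination are proved in one induction through `Q ⧸ N`. A `π'`-group `N` is
absorbed by taking preimages; otherwise `N` is an abelian `π`-group, and a complement of `N` in the
preimage `M` is the required Hall subgroup. -/
theorem exists_hall_dominating {π : Set Nat.Primes} {Q : Type u} [Group Q] [Finite Q]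
    (hQ : IsPiSoluble π Q) : ∃ H : Subgroup Q, IsHallSubgroup πᶜ H ∧
      ∀ A : Subgroup Q, IsPrimeSetNumber πᶜ (Nat.card A) →
        ∃ g : Q, A ≤ H.map (MulAut.conj g).toMonoidHom := by
  induction hc : Nat.card Q using Nat.strong_induction_on generalizing Q with
  | _ c ih =>
  subst hc
  rcases subsingleton_or_nontrivial Q with hs | hnt
  · refine ⟨⊤, ⟨?_, by simpa using IsPrimeSetNumber.one _⟩, fun A _ => ⟨1, fun a _ => ?_⟩⟩
    · rw [card_top, Nat.card_of_subsingleton (1 : Q)]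
      exact IsPrimeSetNumber.one _
    · exact mem_map_conj.2 (mem_top _)
  obtain ⟨N, hN, hNb, hcase⟩ := hQ.exists_normal
  have hsurj := QuotientGroup.mk'_surjective N
  have hlt : Nat.card (Q ⧸ N) < Nat.card Q := by
    rw [← N.card_mul_index, ← index_eq_card]
    exact lt_mul_of_one_lt_left (Nat.pos_of_ne_zero N.index_ne_zero_of_finite)
      ((one_lt_card_iff_ne_bot N).2 hNb)
  obtain ⟨H, hH, hdom⟩ := ih _ hlt (hQ.of_surjective _ hsurj) rfl
  set M := H.comap (QuotientGroup.mk' N) with hM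
  have hNM : N ≤ M := by
    simpa using (QuotientGroup.mk' N).ker_le_comap H
  have hNMi : N.relIndex M = Nat.card H := by
    have h := relIndex_ker M (QuotientGroup.mk' N)
    rwa [QuotientGroup.ker_mk', hM, map_comap_eq_self_of_surjective hsurj] at h
  have hMi : IsPrimeSetNumber πᶜᶜ M.index := by
    rw [hM, index_comap_of_surjective _ hsurj]
    exact hH.2
  have hdomM : ∀ A : Subgroup Q, IsPrimeSetNumber πᶜ (Nat.card A) →
      ∃ g : Q, A ≤ M.map (MulAut.conj g).toMonoidHom := by
    intro A hA
    obtain ⟨g, hg⟩ := hdom (A.map (QuotientGroup.mk' N)) (hA.dvd (card_map_dvd A _))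
    obtain ⟨g, rfl⟩ := hsurj g
    refine ⟨g, fun a ha => mem_map_conj.2 ?_⟩
    simpa [hM] using mem_map_conj.1 (hg (mem_map_of_mem _ ha))
  rcases hcase with hN' | ⟨hNc, hN'⟩
  · refine ⟨M, ⟨?_, hMi⟩, hdomM⟩
    rw [← relIndex_bot_left, ← relIndex_mul_relIndex ⊥ N M bot_le hNM, relIndex_bot_left, hNMi]
    exact hN'.mul hH.1
  · have hcN : Nat.card (N.subgroupOf M) = Nat.card N :=
      Nat.card_congr (subgroupOfEquivOfLe hNM).toEquiv
    obtain ⟨K, hK⟩ := exists_right_complement'_of_coprime (N := N.subgroupOf M)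
      (by rw [hcN, ← relIndex, hNMi]; exact (hH.1.coprime hN').symm)
    have hKc : Nat.card (K.map M.subtype) = Nat.card H := by
      rw [card_map_of_injective M.subtype_injective, ← hK.symm.index_eq_card, ← relIndex, hNMi]
    refine ⟨K.map M.subtype, ⟨hKc ▸ hH.1, ?_⟩, fun A hA => ?_⟩
    · rw [index_map_subtype, hK.index_eq_card, hcN]
      exact hN'.mul hMi
    -- Conjugate `A` into `M = NK` first, then into `K` by coprimeness with `N`.
    · obtain ⟨g, hg⟩ := hdomM A hA
      have hMK : M ≤ N ⊔ K.map M.subtype := by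
        have h := congrArg (Subgroup.map M.subtype) hK.sup_eq_top
        rw [Subgroup.map_sup, map_subgroupOf_eq_of_le hNM, ← MonoidHom.range_eq_map,
          range_subtype] at h
        exact h.ge
      obtain ⟨x, hx⟩ := exists_le_conj_of_le_sup (N := N) (K := K.map M.subtype)
        (A := A.map (MulAut.conj g⁻¹).toMonoidHom) (hKc ▸ (hH.1.coprime hN').symm)
        (by rw [card_map_conj]; exact (hA.coprime hN').symm) (by
          refine le_trans ?_ hMK
          rintro _ ⟨a, ha, rfl⟩
          simpa using mem_map_conj.1 (hg ha))
      refine ⟨g * x, fun a ha => mem_map_conj.2 ?_⟩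
      simpa [mul_assoc] using mem_map_conj.1 (hx (mem_map_of_mem _ ha))

theorem exists_hall {π : Set Nat.Primes} {Q : Type u} [Group Q] [Finite Q]
    (hQ : IsPiSoluble π Q) : ∃ H : Subgroup Q, IsHallSubgroup πᶜ H :=
  let ⟨H, hH, _⟩ := hQ.exists_hall_dominating
  ⟨H, hH⟩

theorem exists_hall_ge {π : Set Nat.Primes} {Q : Type u} [Group Q] [Finite Q]
    (hQ : IsPiSoluble π Q) {A : Subgroup Q} (hA : IsPrimeSetNumber πᶜ (Nat.card A)) :
    ∃ H : Subgroup Q, IsHallSubgroup πᶜ H ∧ A ≤ H :=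
  let ⟨_, hH, hdom⟩ := hQ.exists_hall_dominating
  let ⟨g, hg⟩ := hdom A hA
  ⟨_, hH.map_conj g, hg⟩

theorem hall_conj {π : Set Nat.Primes} {Q : Type u} [Group Q] [Finite Q]
    (hQ : IsPiSoluble π Q) {A B : Subgroup Q} (hA : IsHallSubgroup πᶜ A)
    (hB : IsHallSubgroup πᶜ B) : ∃ g : Q, B = A.map (MulAut.conj g).toMonoidHom := by
  obtain ⟨H, hH, hdom⟩ := hQ.exists_hall_dominating
  obtain ⟨a, ha⟩ := hdom A hA.1
  obtain ⟨b, hb⟩ := hdom B hB.1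
  have ha' := hA.eq_of_le (hH.map_conj a).1 ha
  have hb' := hB.eq_of_le (hH.map_conj b).1 hb
  refine ⟨b * a⁻¹, ?_⟩
  rw [← ha', ← hb']
  ext x
  simp [mul_assoc]

end IsPiSoluble

/-! ### Radicals and restriction of Fitting sets. -/

namespace FittingSet

open Subgroup

variable {G : Type u} [Group G]

theorem bot_mem (F : FittingSet G) : (⊥ : Subgroup G) ∈ F := by
  obtain ⟨S, hS⟩ := F.nonempty'
  exact F.normal_mem' S ⊥ hS bot_le (by rw [bot_subgroupOf]; infer_instance)

theorem le_radical (F : FittingSet G) {H N : Subgroup G} (h : N ≤ H)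
    (hn : (N.subgroupOf H).Normal) (hN : N ∈ F) : N ≤ F.radical H :=
  le_sSup ⟨h, hn, hN⟩

theorem _root_.Subgroup.normal_subgroupOf_mono {N H K : Subgroup G} (hNK : N ≤ K) (hKH : K ≤ H)
    (h : (N.subgroupOf H).Normal) : (N.subgroupOf K).Normal :=
  (normal_subgroupOf_iff hNK).2 fun x k hx hk =>
    (normal_subgroupOf_iff (hNK.trans hKH)).1 h x k hx (hKH hk)

/-- By closure under normal products, a maximal normal `F`-subgroup of `H` absorbs all the others.
-/
theorem radical_mem [Finite G] (F : FittingSet G) (H : Subgroup G) : F.radical H ∈ F := by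
  set s := {N : Subgroup G | N ≤ H ∧ (N.subgroupOf H).Normal ∧ N ∈ F} with hs
  obtain ⟨M, hM⟩ := (Set.toFinite s).exists_maximal
    ⟨⊥, bot_le, by rw [bot_subgroupOf]; infer_instance, F.bot_mem⟩
  obtain ⟨hMH, hMn, hMF⟩ := hM.prop
  have h : F.radical H = M := by
    refine le_antisymm (sSup_le ?_) (F.le_radical hMH hMn hMF)
    rintro N ⟨hNH, hNn, hNF⟩
    have hsup : N ⊔ M ∈ s := by
      refine ⟨sup_le hNH hMH, ?_, F.mul_mem' N M hNF hMF
        (normal_subgroupOf_mono le_sup_left (sup_le hNH hMH) hNn)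
        (normal_subgroupOf_mono le_sup_right (sup_le hNH hMH) hMn)⟩
      rw [subgroupOf_sup hNH hMH]
      infer_instance
    exact le_sup_left.trans (hM.le_of_ge hsup le_sup_right)
  rw [h]
  exact hMF

theorem radical_eq_self (F : FittingSet G) {H : Subgroup G} (h : H ∈ F) : F.radical H = H :=
  le_antisymm (F.radical_le H) <| F.le_radical le_rfl (by rw [subgroupOf_self]; infer_instance) h

theorem radical_normal_of_normal (F : FittingSet G) {H K : Subgroup G} (hKH : K ≤ H)
    (hn : (K.subgroupOf H).Normal) : ((F.radical K).subgroupOf H).Normal := by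
  rw [normal_subgroupOf_iff ((F.radical_le K).trans hKH)]
  intro x k hx hk
  have hK : ∀ y, k⁻¹ * y * k ∈ K ↔ y ∈ K := by
    have h := (normal_subgroupOf_iff hKH).1 hn
    intro y
    refine ⟨fun hy => ?_, fun hy => by simpa using h y k⁻¹ hy (H.inv_mem hk)⟩
    simpa [mul_assoc] using h _ k hy hk
  have key : F.radical K ≤ (F.radical K).comap (MulAut.conj k).toMonoidHom := by
    refine sSup_le ?_
    rintro N ⟨hNK, hNn, hNF⟩
    rw [← map_le_iff_le_comap]
    have hle : N.map (MulAut.conj k).toMonoidHom ≤ K := by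
      intro y hy
      exact (hK y).1 (hNK (mem_map_conj.1 hy))
    refine F.le_radical hle ((normal_subgroupOf_iff hle).2 fun y z hy hz => ?_)
      (F.conj_mem' N k hNF)
    rw [mem_map_conj] at hy ⊢
    simpa [mul_assoc] using
      (normal_subgroupOf_iff hNK).1 hNn _ _ hy ((hK z).2 hz)
  simpa using key hx

theorem radical_eq_inf [Finite G] (F : FittingSet G) {H K : Subgroup G} (hKH : K ≤ H)
    (hn : (K.subgroupOf H).Normal) : F.radical K = F.radical H ⊓ K := by
  refine le_antisymm (le_inf (F.le_radical ((F.radical_le K).trans hKH)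
    (F.radical_normal_of_normal hKH hn) (F.radical_mem K)) (F.radical_le K)) ?_
  have hinf : ((F.radical H ⊓ K).subgroupOf H).Normal := by
    have h := F.radical_subgroupOf_normal H
    exact normal_inf_normal ((F.radical H).subgroupOf H) (K.subgroupOf H)
  refine F.le_radical inf_le_right (normal_subgroupOf_mono inf_le_right hKH hinf) ?_
  exact F.normal_mem' _ _ (F.radical_mem H) inf_le_left
    (normal_subgroupOf_mono inf_le_left (F.radical_le H) hinf)

theorem _root_.Subgroup.normal_subgroupOf_map_subtype_iff {K : Subgroup G} {S T : Subgroup K}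
    (h : T ≤ S) : ((T.map K.subtype).subgroupOf (S.map K.subtype)).Normal ↔
      (T.subgroupOf S).Normal := by
  rw [normal_subgroupOf_iff h, normal_subgroupOf_iff (map_mono h)]
  constructor
  · intro hn t s ht hs
    obtain ⟨y, hy, hy'⟩ := hn t s (mem_map_of_mem _ ht) (mem_map_of_mem _ hs)
    rwa [show s * t * s⁻¹ = y from Subtype.ext hy'.symm]
  · rintro hn _ _ ⟨t, ht, rfl⟩ ⟨s, hs, rfl⟩
    exact ⟨_, hn t s ht hs, rfl⟩

/-- The members of a Fitting set of `G` lying in a subgroup `K`, as a Fitting set of `K`. -/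
def restrict (F : FittingSet G) (K : Subgroup G) : FittingSet K where
  carrier := {S | S.map K.subtype ∈ F}
  nonempty' := ⟨⊥, by
    change (⊥ : Subgroup K).map K.subtype ∈ F
    rw [Subgroup.map_bot]; exact F.bot_mem⟩
  normal_mem' S T hS hTS hn :=
    F.normal_mem' _ _ hS (map_mono hTS) ((normal_subgroupOf_map_subtype_iff hTS).2 hn)
  mul_mem' S T hS hT hSn hTn := by
    change (S ⊔ T).map K.subtype ∈ F
    rw [Subgroup.map_sup]
    refine F.mul_mem' _ _ hS hT ?_ ?_ <;> rw [← Subgroup.map_sup]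
    · exact (normal_subgroupOf_map_subtype_iff le_sup_left).2 hSn
    · exact (normal_subgroupOf_map_subtype_iff le_sup_right).2 hTn
  conj_mem' S x hS := by
    have h := F.conj_mem' _ (x : G) hS
    change (S.map (MulAut.conj x).toMonoidHom).map K.subtype ∈ F
    rw [Subgroup.map_map] at h ⊢
    exact h

theorem mem_restrict {F : FittingSet G} {K : Subgroup G} {S : Subgroup K} :
    S ∈ F.restrict K ↔ S.map K.subtype ∈ F :=
  Iff.rfl

/-- This lets results about the whole group be applied with a subgroup `K` as the ambient group. -/
theorem map_radical_restrict [Finite G] (F : FittingSet G) {K : Subgroup G} (S : Subgroup K) :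
    ((F.restrict K).radical S).map K.subtype = F.radical (S.map K.subtype) := by
  refine le_antisymm (F.le_radical (map_mono (radical_le _ _))
    ((normal_subgroupOf_map_subtype_iff (radical_le _ _)).2 inferInstance)
    ((F.restrict K).radical_mem S)) ?_
  have hle : F.radical (S.map K.subtype) ≤ S.map K.subtype := F.radical_le _
  have heq := map_subgroupOf_eq_of_le (hle.trans (map_subtype_le S))
  rw [← heq] at hle ⊢
  have hle' := (map_le_map_iff_of_injective K.subtype_injective).1 hle
  refine map_mono (le_radical _ hle' ?_ ?_)
  · rw [← normal_subgroupOf_map_subtype_iff hle', heq]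
    infer_instance
  · rw [mem_restrict, heq]
    exact F.radical_mem _

theorem relIndex_radical_restrict [Finite G] (F : FittingSet G) {K : Subgroup G}
    (S : Subgroup K) : ((F.restrict K).radical S).relIndex S =
      (F.radical (S.map K.subtype)).relIndex (S.map K.subtype) := by
  rw [← map_radical_restrict, relIndex_map_map_of_injective _ _ K.subtype_injective]

/-- `F` consists of the subgroups that are extensions of their `X`-radical by a `σ`-group. -/
def IsExtensionBy (F X : FittingSet G) (σ : Set Nat.Primes) : Prop :=
  ∀ H : Subgroup G, H ∈ F ↔ IsPrimeSetNumber σ ((X.radical H).relIndex H)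

/-- `X` is closed under extensions by `p`-groups for all `p ∈ π`. -/
def IsFullAt (X : FittingSet G) (π : Set Nat.Primes) : Prop :=
  ∀ p ∈ π, ∀ (H : Subgroup G) (k : ℕ), (X.radical H).relIndex H = (p : ℕ) ^ k → H ∈ X

theorem IsExtensionBy.restrict [Finite G] {F X : FittingSet G} {σ : Set Nat.Primes}
    (h : F.IsExtensionBy X σ) (K : Subgroup G) : (F.restrict K).IsExtensionBy (X.restrict K) σ :=
  fun S => by rw [mem_restrict, h, relIndex_radical_restrict]

theorem IsFullAt.restrict [Finite G] {X : FittingSet G} {π : Set Nat.Primes}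
    (h : X.IsFullAt π) (K : Subgroup G) : (X.restrict K).IsFullAt π :=
  fun p hp S k hk => h p hp _ k (by rw [← relIndex_radical_restrict, hk])

theorem _root_.Subgroup.card_map_mk' {N V : Subgroup G} [N.Normal] :
    Nat.card (V.map (QuotientGroup.mk' N)) = N.relIndex V := by
  rw [← relIndex_ker, QuotientGroup.ker_mk']

theorem radical_top_inf [Finite G] (X : FittingSet G) (M : Subgroup G) [M.Normal] :
    X.radical M = X.radical ⊤ ⊓ M :=
  X.radical_eq_inf le_top inferInstance

theorem IsInjector.isMaximalIn_top {F : FittingSet G} {V : Subgroup G} (hV : F.IsInjector V) :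
    F.IsMaximalIn ⊤ V := by
  simpa using hV ⊤ IsSubnormal.top

/-! ### The quotient by the `X`-radical, `F`-maximal subgroups and injectors. -/

section Quotient

variable [Finite G] {F X : FittingSet G} {π : Set Nat.Primes}

theorem IsExtensionBy.radical_le_radical {σ : Set Nat.Primes} (hF : F.IsExtensionBy X σ)
    (H : Subgroup G) : X.radical H ≤ F.radical H := by
  refine F.le_radical (X.radical_le H) inferInstance ((hF _).2 ?_)
  rw [X.radical_eq_self (X.radical_mem H), relIndex_self]
  exact IsPrimeSetNumber.one σ

theorem IsExtensionBy.mem_of_relIndex {σ : Set Nat.Primes} (hF : F.IsExtensionBy X σ)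
    {V : Subgroup G} (h : X.radical ⊤ ≤ V)
    (hV : IsPrimeSetNumber σ ((X.radical ⊤).relIndex V)) : V ∈ F :=
  (hF V).2 <| hV.dvd <| relIndex_dvd_of_le_left V <|
    X.le_radical h normal_subgroupOf (X.radical_mem ⊤)

theorem IsExtensionBy.card_map_radical {σ : Set Nat.Primes} (hF : F.IsExtensionBy X σ) :
    IsPrimeSetNumber σ (Nat.card ((F.radical ⊤).map (QuotientGroup.mk' (X.radical ⊤)))) := by
  have h := (hF _).1 (F.radical_mem ⊤)
  rwa [X.radical_top_inf, inf_relIndex_right, ← card_map_mk'] at h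

theorem IsExtensionBy.centralizer_le (hF : F.IsExtensionBy X πᶜ) (hX : X.IsFullAt π)
    (hsol : IsPiSoluble π (G ⧸ X.radical ⊤)) :
    centralizer ((F.radical ⊤).map (QuotientGroup.mk' (X.radical ⊤)) : Set (G ⧸ X.radical ⊤)) ≤
      (F.radical ⊤).map (QuotientGroup.mk' (X.radical ⊤)) := by
  set N := X.radical ⊤ with hN
  have hsurj := QuotientGroup.mk'_surjective N
  have hnorm : ((F.radical ⊤).map (QuotientGroup.mk' N)).Normal :=
    Normal.map inferInstance _ hsurj
  -- Preimages of normal subgroups have `X`-radical exactly `N`, so membership in `F` or `X` can be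
  -- read off from `|M|`.
  have hpre : ∀ M : Subgroup (G ⧸ N), M.Normal →
      N ≤ M.comap (QuotientGroup.mk' N) ∧
      X.radical (M.comap (QuotientGroup.mk' N)) = N ∧
      N.relIndex (M.comap (QuotientGroup.mk' N)) = Nat.card M := by
    intro M hM
    have hle : N ≤ M.comap (QuotientGroup.mk' N) := by
      simpa using (QuotientGroup.mk' N).ker_le_comap M
    refine ⟨hle, ?_, ?_⟩
    · rw [X.radical_top_inf, ← hN, inf_eq_left.2 hle]
    · rw [← card_map_mk', map_comap_eq_self_of_surjective hsurj]
  refine hsol.centralizer_le hF.card_map_radical ?_ ?_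
  · intro M hM hMc
    obtain ⟨hle, -, hcard⟩ := hpre M hM
    rw [← map_comap_eq_self_of_surjective hsurj M]
    refine map_mono (F.le_radical le_top inferInstance ?_)
    exact hF.mem_of_relIndex hle (hcard ▸ hMc)
  · intro p hp P hP hPp
    obtain ⟨hle, hrad, hcard⟩ := hpre P hP
    have : Fact (p : ℕ).Prime := ⟨p.2⟩
    obtain ⟨k, hk⟩ := IsPGroup.iff_card.1 hPp
    have hmem : P.comap (QuotientGroup.mk' N) ∈ X := hX p hp _ k (by rw [hrad, hcard, hk])
    rw [← card_eq_one, ← hcard, relIndex_eq_one]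
    exact X.le_radical le_top inferInstance hmem

/-- The commutators of `X.radical V` with `F.radical ⊤` lie in both, hence in `N`; the centralizer
bound finishes. -/
theorem IsExtensionBy.radical_eq (hF : F.IsExtensionBy X πᶜ) (hX : X.IsFullAt π)
    (hsol : IsPiSoluble π (G ⧸ X.radical ⊤)) {V : Subgroup G} (hV : F.radical ⊤ ≤ V) :
    X.radical V = X.radical ⊤ := by
  set N := X.radical ⊤ with hN
  have hNR : N ≤ F.radical ⊤ := hF.radical_le_radical ⊤
  have hR : X.radical (F.radical ⊤) = N := by
    rw [X.radical_top_inf, ← hN, inf_eq_left.2 hNR]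
  have hR' : X.radical V ⊓ F.radical ⊤ = N := by
    rw [← X.radical_eq_inf hV normal_subgroupOf, hR]
  have hcent : X.radical V ≤ F.radical ⊤ := by
    have h : (X.radical V).map (QuotientGroup.mk' N) ≤
        (F.radical ⊤).map (QuotientGroup.mk' N) := by
      refine le_trans ?_ (hF.centralizer_le hX hsol)
      rintro _ ⟨x, hx, rfl⟩
      rw [mem_centralizer_iff]
      rintro _ ⟨r, hr, rfl⟩
      rw [← map_mul, ← map_mul]
      refine QuotientGroup.eq.2 (?_ : (r * x)⁻¹ * (x * r) ∈ N)
      rw [← hR']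
      have e : (r * x)⁻¹ * (x * r) = x⁻¹ * (r⁻¹ * x * r) := by group
      refine ⟨?_, ?_⟩
      · rw [e]
        refine (X.radical V).mul_mem ((X.radical V).inv_mem hx) ?_
        simpa using (normal_subgroupOf_iff (X.radical_le V)).1 inferInstance x r⁻¹ hx
          (V.inv_mem (hV hr))
      · rw [show (r * x)⁻¹ * (x * r) = x⁻¹ * r⁻¹ * x * r by group]
        refine (F.radical ⊤).mul_mem ?_ hr
        simpa using (radical_top_normal F).conj_mem _ (inv_mem hr) x⁻¹
    intro x hx
    obtain ⟨r, hr, hrx⟩ := h (mem_map_of_mem _ hx)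
    exact (mul_mem_cancel_left (inv_mem hr)).1 (hNR (QuotientGroup.eq.1 hrx))
  rw [← hR', inf_eq_left.2 hcent]

theorem IsExtensionBy.isMaximalIn_top_iff (hF : F.IsExtensionBy X πᶜ) (hX : X.IsFullAt π)
    (hsol : IsPiSoluble π (G ⧸ X.radical ⊤)) (V : Subgroup G) :
    F.IsMaximalIn ⊤ V ∧ F.radical ⊤ ≤ V ↔
      X.radical ⊤ ≤ V ∧ IsHallSubgroup πᶜ (V.map (QuotientGroup.mk' (X.radical ⊤))) := by
  have hNR : X.radical ⊤ ≤ F.radical ⊤ := hF.radical_le_radical ⊤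
  have hsurj := QuotientGroup.mk'_surjective (X.radical ⊤)
  have hcard : ∀ {U : Subgroup G}, F.radical ⊤ ≤ U → U ∈ F →
      IsPrimeSetNumber πᶜ (Nat.card (U.map (QuotientGroup.mk' (X.radical ⊤)))) := by
    intro U hRU hU
    rw [card_map_mk', ← hF.radical_eq hX hsol hRU]
    exact (hF U).1 hU
  have hcm : ∀ {U : Subgroup G}, X.radical ⊤ ≤ U →
      (U.map (QuotientGroup.mk' (X.radical ⊤))).comap (QuotientGroup.mk' (X.radical ⊤)) = U :=
    fun h => comap_map_eq_self (by rwa [QuotientGroup.ker_mk'])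
  constructor
  · rintro ⟨⟨-, hVF, hmax⟩, hRV⟩
    refine ⟨hNR.trans hRV, ?_⟩
    obtain ⟨H, hH, hVH⟩ := hsol.exists_hall_ge (hcard hRV hVF)
    have hle : V ≤ H.comap (QuotientGroup.mk' (X.radical ⊤)) := map_le_iff_le_comap.1 hVH
    have hmem : H.comap (QuotientGroup.mk' (X.radical ⊤)) ∈ F := by
      refine hF.mem_of_relIndex (hNR.trans (hRV.trans hle)) ?_
      rw [← card_map_mk', map_comap_eq_self_of_surjective hsurj]
      exact hH.1
    rw [← hmax _ hle le_top hmem, map_comap_eq_self_of_surjective hsurj]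
    exact hH
  · rintro ⟨hNV, hH⟩
    have hRV : F.radical ⊤ ≤ V := by
      have : ((F.radical ⊤).map (QuotientGroup.mk' (X.radical ⊤))).Normal :=
        Normal.map inferInstance _ hsurj
      rw [← hcm hNV]
      exact map_le_iff_le_comap.1 (hH.normal_le hF.card_map_radical)
    refine ⟨⟨le_top, hF.mem_of_relIndex hNV ?_, fun U hVU _ hU => ?_⟩, hRV⟩
    · rw [← card_map_mk']
      exact hH.1
    rw [← hcm hNV, ← hcm (hNV.trans hVU),
      hH.eq_of_le (hcard (hRV.trans hVU) hU) (map_mono hVU)]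

theorem radical_eq_inf_of_isSubnormal (X : FittingSet G) {K : Subgroup G} (hK : K.IsSubnormal) :
    X.radical K = X.radical ⊤ ⊓ K := by
  induction hK with
  | top => simp
  | step H K hle hK hn ih => rw [X.radical_eq_inf hle hn, ih, inf_assoc, inf_eq_right.2 hle]

theorem _root_.Subgroup.IsSubnormal.relIndex_dvd_index {K : Subgroup G} (hK : K.IsSubnormal)
    (V : Subgroup G) : V.relIndex K ∣ V.index := by
  induction hK with
  | top => simp
  | step H K hle hK hn ih => exact (relIndex_dvd_relIndex_of_normal_right V hle hn).trans ih

theorem IsExtensionBy.isInjector_of_isHallSubgroup (hF : F.IsExtensionBy X πᶜ)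
    (hX : X.IsFullAt π) (hsol : IsPiSoluble π (G ⧸ X.radical ⊤)) {V : Subgroup G}
    (hNV : X.radical ⊤ ≤ V)
    (hV : IsHallSubgroup πᶜ (V.map (QuotientGroup.mk' (X.radical ⊤)))) : F.IsInjector V := by
  intro K hK
  -- This embeds `K` modulo its `X`-radical into `G ⧸ X.radical ⊤`, so the criterion for
  -- `F`-maximality applies inside `K`.
  have hrad : (X.restrict K).radical ⊤ = (X.radical ⊤).subgroupOf K := by
    apply map_injective K.subtype_injective
    rw [map_radical_restrict, ← MonoidHom.range_eq_map, range_subtype, subgroupOf_map_subtype,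
      X.radical_eq_inf_of_isSubnormal hK]
  have hsolK : IsPiSoluble π (K ⧸ (X.restrict K).radical ⊤) := by
    refine hsol.of_injective (QuotientGroup.map _ _ K.subtype hrad.le) ?_
    rw [← MonoidHom.ker_eq_bot_iff, eq_bot_iff]
    intro q hq
    obtain ⟨k, rfl⟩ := QuotientGroup.mk_surjective q
    have hk : (k : G) ∈ X.radical ⊤ := (QuotientGroup.eq_one_iff (k : G)).1 hq
    refine (QuotientGroup.eq_one_iff k).2 ?_
    rw [hrad]
    exact hk
  have hle : (X.restrict K).radical ⊤ ≤ V.subgroupOf K := hrad.le.trans (comap_mono hNV)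
  have hmax := (((hF.restrict K).isMaximalIn_top_iff (hX.restrict K) hsolK
    (V.subgroupOf K)).2 ⟨hle, ?_, ?_⟩).1
  · have hmap : (V.subgroupOf K).map K.subtype = V ⊓ K := subgroupOf_map_subtype V K
    refine ⟨inf_le_right, ?_, fun U hVU hUK hU => ?_⟩
    · rw [← hmap]
      exact hmax.2.1
    · have hUm := map_subgroupOf_eq_of_le hUK
      rw [← hmap, ← hUm]
      congr 1
      refine hmax.2.2 _ ?_ le_top ?_
      · rw [← inf_subgroupOf_right V K]
        exact comap_mono hVU
      · rwa [mem_restrict, hUm]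
  · have h := hV.1
    rw [card_map_mk'] at h ⊢
    refine h.dvd ?_
    rw [hrad, ← inf_subgroupOf_right V K, relIndex_subgroupOf inf_le_right]
    exact relIndex_dvd_relIndex_of_normal inf_le_left normal_subgroupOf
  · have h := hV.2
    rw [index_map_eq _ (QuotientGroup.mk'_surjective _) (by rwa [QuotientGroup.ker_mk'])] at h ⊢
    -- Subnormality is what makes `|K : V ∩ K|` divide `|G : V|`.
    exact h.dvd (hK.relIndex_dvd_index V)

theorem IsInjector.radical_le {V : Subgroup G} (hV : F.IsInjector V) : F.radical ⊤ ≤ V := by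
  have h := hV _ (radical_top_normal F).isSubnormal
  exact inf_eq_right.1 (h.2.2 _ inf_le_right le_rfl (F.radical_mem ⊤)).symm

theorem IsExtensionBy.isInjector_iff (hF : F.IsExtensionBy X πᶜ)
    (hX : X.IsFullAt π) (hsol : IsPiSoluble π (G ⧸ X.radical ⊤)) (V : Subgroup G) :
    F.IsInjector V ↔ X.radical ⊤ ≤ V ∧
      IsHallSubgroup πᶜ (V.map (QuotientGroup.mk' (X.radical ⊤))) :=
  ⟨fun h => (hF.isMaximalIn_top_iff hX hsol V).1 ⟨h.isMaximalIn_top, h.radical_le⟩,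
    fun h => hF.isInjector_of_isHallSubgroup hX hsol h.1 h.2⟩

end Quotient

end FittingSet

/-! ### Assembly of the four statements. -/

theorem Subgroup.eq_map_conj_of_map_mk'_eq {G : Type u} [Group G] {N V W : Subgroup G} [N.Normal]
    (hV : N ≤ V) (hW : N ≤ W) {g : G}
    (h : W.map (QuotientGroup.mk' N) = (V.map (QuotientGroup.mk' N)).map
      (MulAut.conj (g : G ⧸ N)).toMonoidHom) : W = V.map (MulAut.conj g).toMonoidHom := by
  have key : ∀ {U : Subgroup G}, N ≤ U → ∀ x : G, x ∈ U ↔ (x : G ⧸ N) ∈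
      U.map (QuotientGroup.mk' N) := by
    intro U hU x
    conv_lhs => rw [← comap_map_eq_self (f := QuotientGroup.mk' N) (H := U)
      (by rwa [QuotientGroup.ker_mk'])]
    rfl
  ext x
  rw [mem_map_conj, key hW, key hV, h, mem_map_conj]
  rfl

namespace FittingSet

open Subgroup

/-- `N` is a variable with an equation because `G_f` is a supremum only propositionally equal to
`X.radical ⊤`; substitution avoids rewriting inside the quotient type. -/
theorem IsExtensionBy.injector_characterizations {G : Type u} [Group G] [Finite G]
    {F X : FittingSet G} {π : Set Nat.Primes} (hF : F.IsExtensionBy X πᶜ) (hX : X.IsFullAt π)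
    (N : Subgroup G) [N.Normal] (hN : N = X.radical ⊤) (hsol : IsPiSoluble π (G ⧸ N)) :
    (∀ V : Subgroup G, F.IsInjector V ↔
      N ≤ V ∧ IsHallSubgroup πᶜ (V.map (QuotientGroup.mk' N))) ∧
    ((∃ V : Subgroup G, F.IsInjector V) ∧
      ∀ V W : Subgroup G, F.IsInjector V → F.IsInjector W →
        ∃ g : G, W = V.map (MulAut.conj g).toMonoidHom) ∧
    (∀ V : Subgroup G, F.IsInjector V ↔ F.IsMaximalIn ⊤ V ∧ F.radical ⊤ ≤ V) ∧
    (IsPiSoluble π G → ∀ V : Subgroup G, F.IsInjector V ↔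
      ∃ K : Subgroup G, IsHallSubgroup πᶜ K ∧ (V : Set G) = (K : Set G) * (N : Set G)) := by
  subst hN
  have hinj := hF.isInjector_iff hX hsol
  have hsurj := QuotientGroup.mk'_surjective (X.radical ⊤)
  refine ⟨hinj, ⟨?_, fun V W hV hW => ?_⟩, fun V => ?_, fun hG V => ?_⟩
  · obtain ⟨H, hH⟩ := hsol.exists_hall
    refine ⟨H.comap (QuotientGroup.mk' (X.radical ⊤)), (hinj _).2 ⟨?_, ?_⟩⟩
    · simpa using (QuotientGroup.mk' (X.radical ⊤)).ker_le_comap H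
    · rwa [map_comap_eq_self_of_surjective hsurj]
  · rw [hinj] at hV hW
    obtain ⟨g, hg⟩ := hsol.hall_conj hV.2 hW.2
    obtain ⟨g, rfl⟩ := hsurj g
    exact ⟨g, eq_map_conj_of_map_mk'_eq hV.1 hW.1 hg⟩
  · rw [hinj, hF.isMaximalIn_top_iff hX hsol]
  · have hmap : ∀ K : Subgroup G, (K ⊔ X.radical ⊤).map (QuotientGroup.mk' (X.radical ⊤)) =
        K.map (QuotientGroup.mk' (X.radical ⊤)) := by
      intro K
      rw [Subgroup.map_sup, QuotientGroup.map_mk'_self, sup_bot_eq]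
    constructor
    · intro hV
      rw [hinj] at hV
      obtain ⟨K, hK⟩ := hG.exists_hall
      obtain ⟨g, hg⟩ := hsol.hall_conj (hK.map hsurj) hV.2
      obtain ⟨g, rfl⟩ := hsurj g
      refine ⟨K.map (MulAut.conj g).toMonoidHom, hK.map_conj g, ?_⟩
      rw [← mul_normal, SetLike.coe_set_eq]
      rw [← hmap K] at hg
      -- `V` is a conjugate of `KN`; as `N` is normal, this is the conjugate of `K` times `N`.
      rw [eq_map_conj_of_map_mk'_eq le_sup_right hV.1 hg, Subgroup.map_sup]
      congr 1
      ext x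
      rw [mem_map_conj]
      simpa using (radical_top_normal X).mem_comm_iff (a := g⁻¹ * x) (b := g)
    · rintro ⟨K, hK, hV⟩
      rw [← mul_normal, SetLike.coe_set_eq] at hV
      rw [hinj, hV, hmap]
      exact ⟨le_sup_right, hK.map hsurj⟩

theorem IsDefinedBy.isExtensionBy {G : Type u} [Group G] [Finite G] {F : FittingSet G}
    {π : Set Nat.Primes} {f : HFunction G} (hF : F.IsDefinedBy π f) {p : Nat.Primes}
    (hinv : ∀ q ∈ π, f q = f p) : F.IsExtensionBy (f p) πᶜ := by
  intro H
  have h : H ∈ F ↔ ∀ q ∈ π, IsPrimeSetNumber {q}ᶜ (((f q).radical H).relIndex H) := by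
    rw [← SetLike.mem_coe, hF, HFunction.SLR, Set.mem_iInter₂]
    exact forall₂_congr fun q _ => ⟨fun h => h.2, fun h => ⟨inferInstance, h⟩⟩
  rw [h]
  constructor
  · intro h q hq hqπ
    have := h q hqπ
    rw [hinv q hqπ] at this
    exact this q hq rfl
  · rintro h q hq r hr rfl
    rw [hinv r hq] at hr
    exact h r hr hq

end FittingSet

theorem HFunction.IsFull.isFullAt {G : Type u} [Group G] [Finite G] {π : Set Nat.Primes}
    {f : HFunction G} (hf : HFunction.IsFull π f) {p : Nat.Primes}
    (hinv : ∀ q ∈ π, f q = f p) : (f p).IsFullAt π := by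
  intro q hq H k hk
  rw [← hinv q hq] at hk ⊢
  rw [← SetLike.mem_coe, hf q hq]
  exact ⟨inferInstance, IsPGroup.of_card hk⟩

theorem HFunction.radical_eq {G : Type u} [Group G] {π : Set Nat.Primes} {f : HFunction G}
    {p : Nat.Primes} (hp : p ∈ π) (hinv : ∀ q ∈ π, f q = f p) :
    HFunction.radical π f = (f p).radical ⊤ := by
  refine le_antisymm (iSup_le fun q => (hinv q q.2 ▸ le_rfl)) ?_
  exact le_iSup (fun q : π => (f q).radical ⊤) ⟨p, hp⟩

theorem theoremB {G : Type u} [Group G] [Finite G] (π : Set Nat.Primes) (hπ : π.Nonempty)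
    (F : FittingSet G) (f : HFunction G) (hF : F.IsDefinedBy π f)
    (hfull : HFunction.IsFull π f) (hinv : HFunction.IsInvariable π f)
    (hsol : IsPiSoluble π (G ⧸ HFunction.radical π f)) :
    (∀ V : Subgroup G, F.IsInjector V ↔
      HFunction.radical π f ≤ V ∧
        IsHallSubgroup πᶜ (V.map (QuotientGroup.mk' (HFunction.radical π f)))) ∧
    ((∃ V : Subgroup G, F.IsInjector V) ∧
      ∀ V W : Subgroup G, F.IsInjector V → F.IsInjector W →
        ∃ g : G, W = V.map (MulAut.conj g).toMonoidHom) ∧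
    (∀ V : Subgroup G, F.IsInjector V ↔ F.IsMaximalIn ⊤ V ∧ F.radical ⊤ ≤ V) ∧
    (IsPiSoluble π G → ∀ V : Subgroup G, F.IsInjector V ↔
      ∃ K : Subgroup G, IsHallSubgroup πᶜ K ∧
        (V : Set G) = (K : Set G) * (HFunction.radical π f : Set G)) := by
  obtain ⟨p, hp⟩ := hπ
  have hp' : ∀ q ∈ π, f q = f p := fun q hq => hinv q hq p hp
  exact (hF.isExtensionBy hp').injector_characterizations (hfull.isFullAt hp') _
    (HFunction.radical_eq hp hp') hsol
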